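/- A \emph{ceer} is a computably enumerable equivalence relation on $\omega$. For equivalence relations $R,S$ on effectively coded sets, $R\le S$ means that there is a computable function $f$ with $x\mathrel R y\iff f(x)\mathrel S f(y)$ for all $x,y$, and $R\equiv S$ (\emph{bi-reducible}) means $R\le S$ and $S\le R$. A \emph{finitely presented semigroup} is a semigroup isomorphic to the quotient $\langle X;\mathcal R\rangle$ of the free semigroup $X^{+}$ of nonempty words over a finite nonempty alphabet $X$ by the congruence $N_{\mathcal R}$ generated by a finite set $\mathcal R\subseteq X^{+}\times X^{+}$; the \emph{word problem} of the presentation is $N_{\mathcal R}$, an equivalence relation on $X^{+}$ (with the usual effective coding of words). A \emph{positive presentation} of a semigroup $S$ is a triple $\langle\omega,\cdot,E\rangle$, where $\cdot$ is a computable binary operation on $\omega$, $E$ is a ceer that is a congruence for $\cdot$, and $\langle\omega,\cdot\rangle/E\cong S$; its word problem is $E$. \textbf{Corollary.} The class of finitely presented semigroups is not $\equiv$-complete for the ceers: there is a ceer $R$ that is not bi-reducible with the word problem of any finitely presented semigroup. More precisely, there is a single ceer $R$ such that (i) $R\not\equiv E$ for every positive presentation $\langle\omega,\cdot,E\rangle$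 of any finitely presented semigroup, and (ii) $R\not\equiv N_{\mathcal R}$ for every finite semigroup presentation $\langle X;\mathcal R\rangle$. This answers negatively the question of Gao and Gerdes whether the class of finitely presented semigroups is $\equiv$-complete for the ceers. -/

import Mathlib

universe u

namespace CeerSemigroup

/-- Words over an alphabet are coded as a first letter followed by a list of letters. -/
def wordEquiv (α : Type*) : FreeSemigroup α ≃ α × List α where
  toFun w := (w.head, w.tail)
  invFun p := ⟨p.1, p.2⟩
  left_inv _ := rfl
  right_inv _ := rfl

/-- The standard effective coding of the nonempty words over a coded alphabet. -/
instance wordPrimcodable {α : Type*} [Primcodable α] : Primcodable (FreeSemigroup α) :=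
  Primcodable.ofEquiv (α × List α) (wordEquiv α)

/-- A ceer: a computably enumerable equivalence relation on the natural numbers. -/
def IsCeer (E : Setoid ℕ) : Prop :=
  REPred fun p : ℕ × ℕ => E p.1 p.2

/-- Computable reducibility `R ≤ S` of equivalence relations, on `ℕ` or on other effectively
coded domains. -/
def Reducible {α β : Type*} [Primcodable α] [Primcodable β]
    (R : Setoid α) (S : Setoid β) : Prop :=
  ∃ f : α → β, Computable f ∧ ∀ x y, R x y ↔ S (f x) (f y)

/-- Bi-reducibility `R ≡ S`. -/
def BiReducible {α β : Type*} [Primcodable α] [Primcodable β]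
    (R : Setoid α) (S : Setoid β) : Prop :=
  Reducible R S ∧ Reducible S R

/-- The congruence on the free semigroup on the letters `0, …, n` generated by finitely many
relations `u = v`. -/
def presentedCon {n : ℕ}
    (rels : Finset (FreeSemigroup (Fin (n + 1)) × FreeSemigroup (Fin (n + 1)))) :
    Con (FreeSemigroup (Fin (n + 1))) :=
  conGen fun u v => (u, v) ∈ rels

/-- The word problem of a finite semigroup presentation, as an equivalence relation on the
nonempty words: two words are related when they are equal in the presented semigroup. -/
def wordProblem {n : ℕ}
    (rels : Finset (FreeSemigroup (Fin (n + 1)) × FreeSemigroup (Fin (n + 1)))) :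
    Setoid (FreeSemigroup (Fin (n + 1))) :=
  (presentedCon rels).toSetoid

/-- `S` is a finitely presented semigroup: it is isomorphic to the quotient of a free semigroup
on a finite nonempty alphabet by the congruence generated by a finite set of pairs of words. -/
def IsFinitelyPresented (S : Type u) [Semigroup S] : Prop :=
  ∃ (n : ℕ) (rels : Finset (FreeSemigroup (Fin (n + 1)) × FreeSemigroup (Fin (n + 1)))),
    Nonempty (S ≃* (presentedCon rels).Quotient)

/-- `(ℕ, mul, E)` is a positive presentation of the semigroup `S`: `mul` is a computable binary
operation on `ℕ`, `E` is a ceer and a congruence for `mul`, and the quotient is isomorphic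
to `S`. The word problem of this presentation is `E`. -/
structure IsPositivePresentation (mul : ℕ → ℕ → ℕ) (E : Setoid ℕ)
    (S : Type u) [Semigroup S] : Prop where
  computable_mul : Computable₂ mul
  ceer : IsCeer E
  congr : ∀ a b c d : ℕ, E a b → E c d → E (mul a c) (mul b d)
  iso : ∃ e : Quotient E ≃ S, ∀ a b : ℕ,
    e (Quotient.mk E (mul a b)) = e (Quotient.mk E a) * e (Quotient.mk E b)

/-- `R` is bi-reducible with the word problem of some positive presentation of `S`. -/
def IsBiReduciblyRealizedBy (R : Setoid ℕ) (S : Type u) [Semigroup S] : Prop :=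
  ∃ (mul : ℕ → ℕ → ℕ) (E : Setoid ℕ), IsPositivePresentation mul E S ∧ BiReducible R E

end CeerSemigroup

namespace CeerSemigroup

/-! Code each `n` together with the stage at which halting below `n` settles. In `tagSetoid` these
codes are singleton classes and all other numbers form one class, which is c.e., so this is a ceer
with infinitely many classes. In an infinite finitely generated semigroup with computable product,
closing an initial segment of codes under products `k` times gives more than `k` elements below a
computable bound (`lt_ncard_image_productBound`). A reduction of its word problem to `tagSetoid`
sends them to distinct tags. By pigeonhole some tag is at least `k`, so its settling time is
computably bounded, which decides halting (`not_exists_computable_bound`). The opposite reduction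
serves only to make the semigroup infinite. -/

open Nat.Partrec (Code)

/-! ### Settling times of the halting problem. -/

/-- The `i`-th program halts on input `0` within `s` steps. -/
def HaltsWithin (i s : ℕ) : Prop :=
  (Code.evaln s (Denumerable.ofNat Code i) 0).isSome = true

theorem HaltsWithin.mono {i s t : ℕ} (h : HaltsWithin i s) (hst : s ≤ t) : HaltsWithin i t := by
  obtain ⟨x, hx⟩ := Option.isSome_iff_exists.1 h
  exact Option.isSome_iff_exists.2 ⟨x, Code.evaln_mono hst hx⟩

theorem primrecRel_haltsWithin : PrimrecRel HaltsWithin := by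
  classical
  refine ⟨inferInstance, ?_⟩
  have : Primrec fun p : ℕ × ℕ =>
      (Code.evaln p.2 (Denumerable.ofNat Code p.1) 0).isSome :=
    Primrec.option_isSome.comp <| Code.primrec_evaln.comp <|
      (Primrec.snd.pair ((Primrec.ofNat Code).comp Primrec.fst)).pair (Primrec.const 0)
  exact this.of_eq fun p => Bool.decide_eq_true.symm

theorem not_computablePred_halts : ¬ ComputablePred fun i => ∃ s, HaltsWithin i s := by
  classical
  intro h
  refine ComputablePred.halting_problem 0 ?_
  obtain ⟨f, hf, hp⟩ := ComputablePred.computable_iff.1 h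
  refine ComputablePred.computable_iff.2
    ⟨fun c => f (Encodable.encode c), hf.comp Computable.encode, funext fun c => ?_⟩
  have hc := congrFun hp (Encodable.encode c)
  refine Eq.trans (propext ?_) hc
  simp only [HaltsWithin, Denumerable.ofNat_encode, Part.dom_iff_mem, Code.evaln_complete,
    Option.isSome_iff_exists]
  exact exists_comm

/-- Some program with index below `n` halts within `t` but not within `s` steps. -/
def NewHalt (n s t : ℕ) : Prop :=
  ∃ i < n, HaltsWithin i t ∧ ¬ HaltsWithin i s

theorem primrecPred_newHalt : PrimrecPred fun p : ℕ × ℕ × ℕ => NewHalt p.1 p.2.1 p.2.2 := by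
  have h : PrimrecRel fun (i : ℕ) (p : ℕ × ℕ) => HaltsWithin i p.2 ∧ ¬ HaltsWithin i p.1 :=
    PrimrecPred.and
      (primrecRel_haltsWithin.comp Primrec.fst (Primrec.snd.comp Primrec.snd))
      (PrimrecPred.not
        (primrecRel_haltsWithin.comp Primrec.fst (Primrec.fst.comp Primrec.snd)))
  refine (h.exists_mem_list.comp (Primrec.list_range.comp Primrec.fst) Primrec.snd).of_eq
    fun p => ?_
  simp only [List.mem_range, NewHalt]

/-- `s` is the first stage at which the halting problem below `n` has settled. -/
def IsSettlingTime (n s : ℕ) : Prop :=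
  (∀ t, ¬ NewHalt n s t) ∧ (s = 0 ∨ NewHalt n (s - 1) s)

theorem exists_forall_not_newHalt (n : ℕ) : ∃ s, ∀ t, ¬ NewHalt n s t := by
  induction n with
  | zero => exact ⟨0, fun t ⟨i, hi, _⟩ => absurd hi (Nat.not_lt_zero i)⟩
  | succ n ih =>
    obtain ⟨s, hs⟩ := ih
    by_cases h : ∃ u, HaltsWithin n u
    · obtain ⟨u, hu⟩ := h
      refine ⟨max s u, fun t ⟨i, hi, hit, hn⟩ => ?_⟩
      rcases Nat.lt_succ_iff_lt_or_eq.1 hi with hi | rfl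
      · exact hs t ⟨i, hi, hit, fun h => hn (h.mono (le_max_left _ _))⟩
      · exact hn (hu.mono (le_max_right _ _))
    · refine ⟨s, fun t ⟨i, hi, hit, hn⟩ => ?_⟩
      rcases Nat.lt_succ_iff_lt_or_eq.1 hi with hi | rfl
      · exact hs t ⟨i, hi, hit, hn⟩
      · exact h ⟨t, hit⟩

theorem exists_isSettlingTime (n : ℕ) : ∃ s, IsSettlingTime n s := by
  classical
  have h := exists_forall_not_newHalt n
  refine ⟨Nat.find h, Nat.find_spec h, ?_⟩
  rcases Nat.eq_zero_or_pos (Nat.find h) with h0 | h0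
  · exact Or.inl h0
  · have := Nat.find_min h (Nat.sub_lt h0 one_pos)
    push Not at this
    obtain ⟨t, i, hi, hit, hn⟩ := this
    refine Or.inr ⟨i, hi, ?_, hn⟩
    by_contra hs
    exact Nat.find_spec h t ⟨i, hi, hit, hs⟩

/-- If `s < t`, the program that first halts at stage `t` is still new after `s`. Used in both
directions, this makes the settling time unique. -/
theorem IsSettlingTime.le {n s t : ℕ} (hs : IsSettlingTime n s) (ht : IsSettlingTime n t) :
    t ≤ s := by
  by_contra! hlt
  rcases ht.2 with rfl | ⟨i, hi, hit, hn⟩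
  · exact absurd hlt (Nat.not_lt_zero s)
  · exact hs.1 t ⟨i, hi, hit, fun h => hn (h.mono (Nat.le_sub_one_of_lt hlt))⟩

/-! ### The ceer built from settling times. -/

/-- A number is tagged by `n` if it codes `n` together with its settling time; all remaining
numbers carry no tag. -/
noncomputable def tag (x : ℕ) : Option ℕ :=
  open Classical in if IsSettlingTime x.unpair.1 x.unpair.2 then some x.unpair.1 else none

theorem tag_eq_some {x n : ℕ} : tag x = some n ↔ ∃ s, IsSettlingTime n s ∧ x = Nat.pair n s := by
  unfold tag
  split_ifs with h
  · constructor
    · intro hx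
      obtain rfl := Option.some.inj hx
      exact ⟨_, h, (Nat.pair_unpair x).symm⟩
    · rintro ⟨s, -, rfl⟩
      simp
  · simp only [false_iff]
    rintro ⟨s, hs, rfl⟩
    exact h (by simpa using hs)

theorem tag_eq_none {x : ℕ} : tag x = none ↔ ¬ IsSettlingTime x.unpair.1 x.unpair.2 := by
  unfold tag
  split_ifs with h <;> simp [h]

theorem tag_eq_tag {x y : ℕ} : tag x = tag y ↔ x = y ∨ (tag x = none ∧ tag y = none) := by
  constructor
  · intro h
    rcases hx : tag x with _ | n
    · exact Or.inr ⟨rfl, h ▸ hx⟩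
    · left
      obtain ⟨s, hs, rfl⟩ := tag_eq_some.1 hx
      obtain ⟨t, ht, rfl⟩ := tag_eq_some.1 (h ▸ hx)
      rw [le_antisymm (ht.le hs) (hs.le ht)]
  · rintro (rfl | ⟨hx, hy⟩)
    · rfl
    · rw [hx, hy]

/-- Stage `t` reveals that `x` carries no tag. -/
def RevealsUntagged (x t : ℕ) : Prop :=
  NewHalt x.unpair.1 x.unpair.2 t ∨
    (x.unpair.2 ≠ 0 ∧ ¬ NewHalt x.unpair.1 (x.unpair.2 - 1) x.unpair.2)

/-- A stage fails to be the settling time because a later halt occurs, which is c.e., or because it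
is not the first such stage, which is decidable. -/
theorem tag_eq_none_iff_exists {x : ℕ} : tag x = none ↔ ∃ t, RevealsUntagged x t := by
  rw [tag_eq_none, IsSettlingTime, not_and_or, not_or]
  simp only [RevealsUntagged, exists_or, exists_const, not_forall, not_not, ne_eq]

theorem primrecRel_revealsUntagged : PrimrecRel RevealsUntagged := by
  have h1 : Primrec fun p : ℕ × ℕ => p.1.unpair.1 :=
    Primrec.fst.comp (Primrec.unpair.comp Primrec.fst)
  have h2 : Primrec fun p : ℕ × ℕ => p.1.unpair.2 :=
    Primrec.snd.comp (Primrec.unpair.comp Primrec.fst)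
  exact PrimrecPred.or
    (primrecPred_newHalt.comp (h1.pair (h2.pair Primrec.snd)))
    (PrimrecPred.and (PrimrecPred.not (Primrec.eq.comp h2 (Primrec.const 0)))
      (PrimrecPred.not
        (primrecPred_newHalt.comp
          (h1.pair ((Primrec.nat_sub.comp h2 (Primrec.const 1)).pair h2)))))

theorem rePred_exists {α : Type*} [Primcodable α] {p : α → ℕ → Prop} (hp : PrimrecRel p) :
    REPred fun a => ∃ n, p a n := by
  classical
  refine (Partrec.rfind hp.decide.to_comp.partrec₂).dom_re.of_eq fun a => ?_
  rw [Nat.rfind_dom]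
  simp

/-- Two numbers are equivalent if they carry the same tag or both carry none. -/
noncomputable def tagSetoid : Setoid ℕ :=
  Setoid.ker tag

theorem tagSetoid_apply {x y : ℕ} : tagSetoid x y ↔ tag x = tag y :=
  Iff.rfl

theorem isCeer_tagSetoid : IsCeer tagSetoid := by
  have h1 : Primrec fun q : (ℕ × ℕ) × ℕ => q.1.1 := Primrec.fst.comp Primrec.fst
  have h2 : Primrec fun q : (ℕ × ℕ) × ℕ => q.1.2 := Primrec.snd.comp Primrec.fst
  have hu : Primrec fun q : (ℕ × ℕ) × ℕ => q.2.unpair := Primrec.unpair.comp Primrec.snd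
  have h : PrimrecRel fun (p : ℕ × ℕ) (k : ℕ) =>
      p.1 = p.2 ∨ (RevealsUntagged p.1 k.unpair.1 ∧ RevealsUntagged p.2 k.unpair.2) :=
    PrimrecPred.or (Primrec.eq.comp h1 h2)
      (PrimrecPred.and (primrecRel_revealsUntagged.comp h1 (Primrec.fst.comp hu))
        (primrecRel_revealsUntagged.comp h2 (Primrec.snd.comp hu)))
  refine (rePred_exists h).of_eq fun p => ?_
  rw [tagSetoid_apply, tag_eq_tag, tag_eq_none_iff_exists, tag_eq_none_iff_exists]
  constructor
  · rintro ⟨k, h | ⟨hx, hy⟩⟩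
    · exact Or.inl h
    · exact Or.inr ⟨⟨_, hx⟩, ⟨_, hy⟩⟩
  · rintro (h | ⟨⟨s, hs⟩, ⟨t, ht⟩⟩)
    · exact ⟨0, Or.inl h⟩
    · exact ⟨Nat.pair s t, Or.inr (by simpa using ⟨hs, ht⟩)⟩

/-- The settling times are not dominated by any computable function. -/
theorem not_exists_computable_bound {h : ℕ → ℕ} (hh : Computable h)
    (hb : ∀ n, ∃ m ≥ n, ∃ s ≤ h n, IsSettlingTime m s) : False := by
  classical
  refine not_computablePred_halts ?_
  have hd : Computable fun i => decide (HaltsWithin i (h (i + 1))) :=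
    primrecRel_haltsWithin.decide.to_comp.comp Computable.id (hh.comp Computable.succ)
  refine hd.computablePred.of_eq fun i => ⟨fun hi => ⟨_, hi⟩, fun ⟨t, ht⟩ => ?_⟩
  -- Asking for `m ≥ i + 1` puts program `i` among those settled by stage `s ≤ h (i + 1)`.
  obtain ⟨m, hm, s, hs, hset⟩ := hb (i + 1)
  by_contra hn
  exact hset.1 t ⟨i, hm, ht, fun hi => hn (hi.mono hs)⟩

/-! ### Computable bounds on codes of products. -/

/-- The maximum of the values of `f` on `0, …, n`. -/
def runningMax (f : ℕ → ℕ) (n : ℕ) : ℕ :=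
  Nat.rec (f 0) (fun k m => max m (f (k + 1))) n

theorem le_runningMax (f : ℕ → ℕ) {k n : ℕ} (h : k ≤ n) : f k ≤ runningMax f n := by
  induction n with
  | zero => rw [Nat.le_zero.1 h]; exact le_rfl
  | succ n ih =>
    rcases Nat.le_succ_iff.1 h with h | rfl
    · exact (ih h).trans (le_max_left _ _)
    · exact le_max_right _ _

theorem computable_runningMax {f : ℕ → ℕ} (hf : Computable f) : Computable (runningMax f) :=
  have hstep : Computable₂ fun (_ : ℕ) (p : ℕ × ℕ) => max p.2 (f (p.1 + 1)) :=
    Primrec.nat_max.to_comp.comp (Computable.snd.comp Computable.snd)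
      (hf.comp (Computable.succ.comp (Computable.fst.comp Computable.snd)))
  Computable.nat_rec Computable.id (Computable.const (f 0)) hstep

/-- Bounds of initial segments of `ℕ`, each containing the products of elements of the previous
one. -/
def productBound (mul : ℕ → ℕ → ℕ) (b : ℕ) (k : ℕ) : ℕ :=
  Nat.rec b (fun _ c => max c (runningMax (Nat.unpaired mul) (Nat.pair c c))) k

theorem productBound_le_succ (mul : ℕ → ℕ → ℕ) (b k : ℕ) :
    productBound mul b k ≤ productBound mul b (k + 1) :=
  le_max_left _ _

theorem mul_le_productBound (mul : ℕ → ℕ → ℕ) (b : ℕ) {k x y : ℕ}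
    (hx : x ≤ productBound mul b k) (hy : y ≤ productBound mul b k) :
    mul x y ≤ productBound mul b (k + 1) := by
  -- The pairing function is monotone in each argument, so the maximum up to `Nat.pair c c` covers
  -- all products of codes up to `c`.
  have hle : Nat.pair x y ≤ Nat.pair (productBound mul b k) (productBound mul b k) :=
    (StrictMono.monotone (fun _ _ => Nat.pair_lt_pair_left y) hx).trans
      (StrictMono.monotone (fun _ _ => Nat.pair_lt_pair_right _) hy)
  have := le_runningMax (Nat.unpaired mul) hle
  simp only [Nat.unpaired, Nat.unpair_pair] at this
  exact this.trans (le_max_right _ _)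

theorem computable_productBound {mul : ℕ → ℕ → ℕ} (hmul : Computable₂ mul) (b : ℕ) :
    Computable (productBound mul b) := by
  have hu : Computable (Nat.unpaired mul) :=
    hmul.comp (Computable.fst.comp Computable.unpair) (Computable.snd.comp Computable.unpair)
  have hc : Computable fun p : ℕ × ℕ × ℕ => p.2.2 := Computable.snd.comp Computable.snd
  have hstep : Computable₂ fun (_ : ℕ) (p : ℕ × ℕ) =>
      max p.2 (runningMax (Nat.unpaired mul) (Nat.pair p.2 p.2)) :=
    Primrec.nat_max.to_comp.comp hc
      ((computable_runningMax hu).comp (Primrec₂.natPair.to_comp.comp hc hc))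
  exact Computable.nat_rec Computable.id (Computable.const b) hstep

theorem infinite_of_injective_tags {T : Type*} {π : ℕ → T} {f : ℕ → ℕ}
    (hf : ∀ x y, tagSetoid x y ↔ π (f x) = π (f y)) : Infinite T := by
  choose s hs using exists_isSettlingTime
  refine Infinite.of_injective (fun n => π (f (Nat.pair n (s n)))) fun m n hmn => ?_
  have h := (hf _ _).2 hmn
  rw [tagSetoid_apply, tag_eq_some.2 ⟨s m, hs m, rfl⟩, tag_eq_some.2 ⟨s n, hs n, rfl⟩] at h
  exact Option.some.inj h

/-! ### Growth in finitely generated semigroups. -/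

section FinitelyGenerated

variable {T : Type*} [Semigroup T] {mul : ℕ → ℕ → ℕ} {π : ℕ → T}

/-- If the generators are coded by numbers up to `b ≤ c` and the elements coded up to `c` are closed
under products, then every element is coded by a number up to `c`. -/
theorem forall_mem_image_of_mul_closed (hmul : ∀ x y, π (mul x y) = π x * π y)
    {n b c : ℕ} {φ : FreeSemigroup (Fin (n + 1)) →ₙ* T} (hφ : Function.Surjective φ)
    (hb : ∀ i, ∃ x ≤ b, π x = φ (FreeSemigroup.of i)) (hbc : b ≤ c)
    (hc : ∀ x ≤ c, ∀ y ≤ c, ∃ z ≤ c, π z = π (mul x y)) (t : T) : ∃ x ≤ c, π x = t := by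
  obtain ⟨w, rfl⟩ := hφ t
  induction w with
  | ih1 i =>
    obtain ⟨x, hx, h⟩ := hb i
    exact ⟨x, hx.trans hbc, h⟩
  | ih2 i w hi hw =>
    obtain ⟨x, hx, hxi⟩ := hi
    obtain ⟨y, hy, hyw⟩ := hw
    obtain ⟨z, hz, h⟩ := hc x hx y hy
    exact ⟨z, hz, by rw [h, hmul, hxi, hyw, map_mul]⟩

/-- Each round of products adds a new element: otherwise the finite set reached so far is closed
under products and contains the generators, hence is all of `T`. -/
theorem lt_ncard_image_productBound [Infinite T] (hmul : ∀ x y, π (mul x y) = π x * π y)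
    {n b : ℕ} {φ : FreeSemigroup (Fin (n + 1)) →ₙ* T} (hφ : Function.Surjective φ)
    (hb : ∀ i, ∃ x ≤ b, π x = φ (FreeSemigroup.of i)) (k : ℕ) :
    k < (π '' Set.Iic (productBound mul b k)).ncard := by
  have hfin (k : ℕ) : (π '' Set.Iic (productBound mul b k)).Finite :=
    (Set.finite_Iic _).image π
  induction k with
  | zero => exact (Set.ncard_pos (hfin 0)).2 ⟨π 0, 0, Nat.zero_le _, rfl⟩
  | succ k ih =>
    have hsub : π '' Set.Iic (productBound mul b k) ⊆ π '' Set.Iic (productBound mul b (k + 1)) :=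
      Set.image_mono (Set.Iic_subset_Iic.2 (productBound_le_succ mul b k))
    refine lt_of_le_of_lt (Nat.succ_le_of_lt ih) (Set.ncard_lt_ncard ?_ (hfin (k + 1)))
    refine hsub.ssubset_of_ne fun heq => ?_
    have hbk : b ≤ productBound mul b k :=
      monotone_nat_of_le_succ (productBound_le_succ mul b) (Nat.zero_le k)
    have hall := forall_mem_image_of_mul_closed hmul hφ hb hbk fun x hx y hy => by
      have : π (mul x y) ∈ π '' Set.Iic (productBound mul b k) :=
        heq ▸ ⟨_, mul_le_productBound mul b hx hy, rfl⟩
      exact this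
    exact Set.infinite_univ ((hfin k).subset fun t _ => hall t)

/-- `tagSetoid` is not bi-reducible with the word problem of a computable multiplication presenting
a finitely generated semigroup. -/
theorem not_biReducible_ker (hcomp : Computable₂ mul) (hmul : ∀ x y, π (mul x y) = π x * π y)
    (hπ : Function.Surjective π) {n : ℕ} {φ : FreeSemigroup (Fin (n + 1)) →ₙ* T}
    (hφ : Function.Surjective φ) : ¬ BiReducible tagSetoid (Setoid.ker π) := by
  rintro ⟨⟨f, -, hf⟩, g, hg, hgr⟩
  have : Infinite T := infinite_of_injective_tags (π := π) (f := f) hf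
  choose r hr using fun i => hπ (φ (FreeSemigroup.of i))
  have hb : ∀ i, ∃ x ≤ Finset.univ.sup r, π x = φ (FreeSemigroup.of i) := fun i =>
    ⟨r i, Finset.le_sup (Finset.mem_univ i), hr i⟩
  set b := Finset.univ.sup r
  refine not_exists_computable_bound
    (h := fun k => runningMax g (productBound mul b (k + 1)))
    ((computable_runningMax hg).comp
      ((computable_productBound hcomp b).comp Computable.succ)) fun k => ?_
  -- Index `k + 1` yields at least `k + 2` elements, one more than the `k + 1` tags to avoid: `none`
  -- and the numbers below `k`.
  have hcard := lt_ncard_image_productBound hmul hφ hb (k + 1)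
  choose ρ hρ using hπ
  have hinj : Function.Injective fun t => tag (g (ρ t)) := fun s t hst => by
    rw [← hρ s, ← hρ t]
    exact (hgr _ _).2 hst
  rw [← Set.ncard_image_of_injective _ hinj] at hcard
  have hlow : (insert none (some '' Set.Iio k) : Set (Option ℕ)).ncard ≤ k + 1 :=
    (Set.ncard_insert_le _ _).trans <| Nat.succ_le_succ <|
      (Set.ncard_image_le (Set.finite_Iio k)).trans (by simp [Set.ncard_eq_toFinset_card'])
  obtain ⟨o, ⟨_, ⟨x, hx, rfl⟩, rfl⟩, ho⟩ := Set.exists_mem_notMem_of_ncard_lt_ncard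
    (hlow.trans_lt hcard) (((Set.finite_Iio k).image some).insert none)
  -- The chosen representative `ρ (π x)` may be large; `x` lies below the bound and its image has
  -- the same tag.
  have htag : tag (g (ρ (π x))) = tag (g x) := (hgr _ _).1 (hρ (π x))
  simp only [htag] at ho
  rcases hm : tag (g x) with _ | m
  · exact absurd (hm ▸ Set.mem_insert _ _) ho
  · obtain ⟨s, hs, hgx⟩ := tag_eq_some.1 hm
    refine ⟨m, ?_, s, ?_, hs⟩
    · by_contra! hlt
      exact ho (hm ▸ Set.mem_insert_of_mem _ ⟨m, hlt, rfl⟩)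
    · exact ((Nat.right_le_pair m s).trans hgx.ge).trans (le_runningMax g hx)

end FinitelyGenerated

/-! ### The two kinds of word problem. -/

theorem not_isBiReduciblyRealizedBy {S : Type*} [Semigroup S] (hS : IsFinitelyPresented S) :
    ¬ IsBiReduciblyRealizedBy tagSetoid S := by
  rintro ⟨mul, E, hE, hR⟩
  obtain ⟨n, rels, ⟨ψ⟩⟩ := hS
  obtain ⟨e, he⟩ := hE.iso
  let φ : FreeSemigroup (Fin (n + 1)) →ₙ* S :=
    { toFun := fun w => ψ.symm (w : (presentedCon rels).Quotient)
      map_mul' := fun v w => by rw [Con.coe_mul, map_mul] }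
  have hφ : Function.Surjective φ := ψ.symm.surjective.comp Quotient.mk_surjective
  have hker : Setoid.ker (fun x => e (Quotient.mk E x)) = E := by
    ext x y
    exact e.injective.eq_iff.trans Quotient.eq
  exact not_biReducible_ker hE.computable_mul he (e.surjective.comp Quotient.mk_surjective) hφ
    (hker.symm ▸ hR)

theorem computable₂_freeSemigroup_mul {α : Type*} [Primcodable α] :
    Computable₂ fun v w : FreeSemigroup α => v * w := by
  have he : Primrec (wordEquiv α) := Primrec.of_equiv
  have hl : Primrec fun p : FreeSemigroup α × FreeSemigroup α => wordEquiv α p.1 :=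
    he.comp Primrec.fst
  have hr : Primrec fun p : FreeSemigroup α × FreeSemigroup α => wordEquiv α p.2 :=
    he.comp Primrec.snd
  have h : Primrec fun p : FreeSemigroup α × FreeSemigroup α => (wordEquiv α).symm
      ((wordEquiv α p.1).1, (wordEquiv α p.1).2 ++
        (wordEquiv α p.2).1 :: (wordEquiv α p.2).2) :=
    Primrec.of_equiv_symm.comp <| (Primrec.fst.comp hl).pair <|
      Primrec.list_append.comp (Primrec.snd.comp hl)
        (Primrec.list_cons.comp (Primrec.fst.comp hr) (Primrec.snd.comp hr))
  exact h.to_comp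

theorem not_biReducible_wordProblem {n : ℕ}
    (rels : Finset (FreeSemigroup (Fin (n + 1)) × FreeSemigroup (Fin (n + 1)))) :
    ¬ BiReducible tagSetoid (wordProblem rels) := by
  rintro ⟨⟨f, hf, hfr⟩, g, hg, hgr⟩
  -- Reading numbers as words moves the word problem to `ℕ`. Numbers that code no word are read as
  -- the default word, which is harmless because `F` only has to be computable and onto.
  let F : ℕ → FreeSemigroup (Fin (n + 1)) := fun x => (Encodable.decode x).getD default
  have hF : Computable F := Computable.option_getD Computable.decode (Computable.const default)
  have hFe (w) : F (Encodable.encode w) = w := by simp [F]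
  let φ : FreeSemigroup (Fin (n + 1)) →ₙ* (presentedCon rels).Quotient :=
    { toFun := fun w => w
      map_mul' := fun _ _ => rfl }
  have hφ : Function.Surjective φ := Quotient.mk_surjective
  have hker (v w) : wordProblem rels v w ↔ φ v = φ w := (Con.eq (presentedCon rels)).symm
  refine not_biReducible_ker (mul := fun x y => Encodable.encode (F x * F y))
    (π := fun x => φ (F x)) ?_ ?_ ?_ hφ ⟨⟨fun x => Encodable.encode (f x), ?_, fun x y => ?_⟩,
      fun x => g (F x), hg.comp hF, fun x y => ?_⟩
  · exact Computable.encode.comp (computable₂_freeSemigroup_mul.comp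
      (hF.comp Computable.fst) (hF.comp Computable.snd))
  · intro x y
    rw [hFe, map_mul]
  · exact hφ.comp fun w => ⟨_, hFe w⟩
  · exact Computable.encode.comp hf
  · rw [Setoid.ker_def, hFe, hFe, hfr, hker]
  · rw [Setoid.ker_def, ← hker, hgr]

end CeerSemigroup

theorem mainTheorem1 :
    ∃ R : Setoid ℕ, CeerSemigroup.IsCeer R ∧
      (∀ (S : Type u) [Semigroup S], CeerSemigroup.IsFinitelyPresented S →
        ¬ CeerSemigroup.IsBiReduciblyRealizedBy R S) ∧
      (∀ (n : ℕ)
        (rels : Finset (FreeSemigroup (Fin (n + 1)) × FreeSemigroup (Fin (n + 1)))),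
        ¬ CeerSemigroup.BiReducible R (CeerSemigroup.wordProblem rels)) :=
  ⟨CeerSemigroup.tagSetoid, CeerSemigroup.isCeer_tagSetoid,
    fun _ _ hS => CeerSemigroup.not_isBiReduciblyRealizedBy hS,
    fun _ rels => CeerSemigroup.not_biReducible_wordProblem rels⟩
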